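/- Let $\mathcal{A}$ be a unital $C^*$-algebra, let $\mathcal{H}$ be a complex Hilbert space with algebra of bounded operators $\mathbf{B}(\mathcal{H})$, and write $|X|=(X^*X)^{1/2}$. For positive invertible $A,B\in\mathbf{B}(\mathcal{H})$ put $A\# B=A^{1/2}(A^{-1/2}BA^{-1/2})^{1/2}A^{1/2}$, and for positive, not necessarily invertible, $A,B\in\mathbf{B}(\mathcal{H})$ let $A\# B$ be the limit, in the strong operator topology, of $(A+rI)\#(B+rI)$ as $r\to0^+$. Let $\Phi:\mathcal{A}\to\mathbf{B}(\mathcal{H})$ be a positive linear map and let $S_1,\dots,S_m\in\mathcal{A}$ be semi-hyponormal, i.e. $|S_k^*|\le|S_k|$ for every $k$. Then there exists a partial isometry $V\in\mathbf{B}(\mathcal{H})$ such that $$\left|\Phi\left(\sum_{k=1}^m S_k\right)\right|\le \Phi\left(\sum_{k=1}^m|S_k|\right)\#\,V\,\Phi\left(\sum_{k=1}^m|S_k|\right)V^*,$$ where the strong limit defining the right-hand side exists. -/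

import Mathlib

open Filter Topology

/-- An element `S` of a C⋆-algebra is semi-hyponormal if `|S⋆| ≤ |S|`, where `|X| = (X⋆X)^{1/2}`. -/
def IsSemiHyponormal {A : Type*} [CStarAlgebra A] [PartialOrder A] [StarOrderedRing A]
    (S : A) : Prop :=
  CFC.abs (star S) ≤ CFC.abs S

/-- A partial isometry: `V V⋆ V = V`. -/
def IsPartialIsometry {H : Type*} [NormedAddCommGroup H] [InnerProductSpace ℂ H]
    [CompleteSpace H] (V : H →L[ℂ] H) : Prop :=
  V * star V * V = V

/-- The geometric mean `A^{1/2} (A^{-1/2} B A^{-1/2})^{1/2} A^{1/2}` of two positive invertible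
bounded operators; the real powers are those of the continuous functional calculus. -/
noncomputable def geomMeanOfInvertible {H : Type*} [NormedAddCommGroup H] [InnerProductSpace ℂ H]
    [CompleteSpace H] (A B : H →L[ℂ] H) : H →L[ℂ] H :=
  A ^ (1 / 2 : ℝ) * (A ^ (-1 / 2 : ℝ) * B * A ^ (-1 / 2 : ℝ)) ^ (1 / 2 : ℝ) * A ^ (1 / 2 : ℝ)

/-- `G` is the geometric mean `A # B` of the positive, not necessarily invertible, bounded
operators `A` and `B`: the limit of `(A + r I) # (B + r I)` as `r → 0⁺` exists in the strong
operator topology, and equals `G`. -/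
def IsGeomMean {H : Type*} [NormedAddCommGroup H] [InnerProductSpace ℂ H]
    [CompleteSpace H] (A B G : H →L[ℂ] H) : Prop :=
  ∀ x : H, Tendsto (fun r : ℝ => geomMeanOfInvertible (A + r • 1) (B + r • 1) x)
    (𝓝[>] 0) (𝓝 (G x))

/-- The geometric mean is unique. -/
theorem IsGeomMean.unique {H : Type*} [NormedAddCommGroup H] [InnerProductSpace ℂ H]
    [CompleteSpace H] {A B G G' : H →L[ℂ] H} (h : IsGeomMean A B G) (h' : IsGeomMean A B G') :
    G = G' :=
  ContinuousLinearMap.ext fun x => tendsto_nhds_unique (h x) (h' x)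

/-!
# Positive maps, semi-hyponormal elements and the geometric mean

Positivity of an operator matrix `[[P, T⋆], [T, Q]]` is the only notion the argument runs on, and
it enters as an inequality between forms, `IsPosBlock P Q T`.

A positive map `Φ` need not be `2`-positive, but it does preserve positivity of blocks with equal
diagonal entries. For a contraction `c` and the block `[[1, c⋆], [c, 1]]` this is
`isPosBlock_map_of_norm_le_one`: if `‖c‖ < 1`, the Poisson kernels `E_j ≥ 0` of `c` at the `N`-th
roots of unity `λ_j` have averages tending to `1` as `N → ∞`, while the averages of `λ_j E_j` tend
to `c`; and each block `[[Φ E_j, conj λ_j Φ E_j], [λ_j Φ E_j, Φ E_j]]` is positive because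
`Φ E_j ≥ 0`. For semi-hyponormal `S` and `Q = |S| + r`, the element `Q^{-1/2} S Q^{-1/2}` is a
contraction, since `S Q⁻¹ S⋆ ≤ |S⋆| ≤ |S| ≤ Q`. Applying the above to `X ↦ Φ (Q^{1/2} X Q^{1/2})`
and letting `r → 0` shows that `[[Φ |S|, (Φ S)⋆], [Φ S, Φ |S|]]` is positive
(`IsSemiHyponormal.isPosBlock_map`). These blocks may be added over `S₁, …, S_m`; write `P` for the
diagonal entry `Φ (∑ |S_k|)` and `T` for the corner `Φ (∑ S_k)` of the sum.

Polar decomposition gives a partial isometry `V` with `V T = |T|`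
(`exists_isPartialIsometry_mul_eq_cfcAbs`). Conjugation by `diag(1, V⋆)` turns the block into
`[[P, |T|], [|T|, V P V⋆]]`. Finally `P # Q` is the largest `X ≥ 0` with `[[P, X], [X, Q]]`
positive: for invertible `P` this reduces to operator monotonicity of the square root. The extremal
property also makes `(P + r) # (Q + r)` increasing in `r`, so the strong limit as `r → 0⁺` exists
by Vigier's theorem and dominates every such `X` (`IsPosBlock.exists_isGeomMean_ge`).
-/

/-! ### Positivity of operator blocks -/

section BlockPositivity

variable {H : Type*} [NormedAddCommGroup H] [InnerProductSpace ℂ H]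

/-- The operator matrix `[[P, T⋆], [T, Q]]` is positive, expressed without matrices: pairing it
with the vectors `(x, ζ y)`, `|ζ| = 1`, and optimising over the phase `ζ` gives this inequality
between sesquilinear forms. -/
def IsPosBlock (P Q T : H →L[ℂ] H) : Prop :=
  ∀ x y : H, 2 * ‖inner ℂ (T x) y‖ ≤ P.reApplyInnerSelf x + Q.reApplyInnerSelf y

theorem reApplyInnerSelf_nonneg {E : H →L[ℂ] H} (hE : 0 ≤ E) (x : H) :
    0 ≤ E.reApplyInnerSelf x :=
  ((ContinuousLinearMap.nonneg_iff_isPositive E).mp hE).2 x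

theorem reApplyInnerSelf_add (E F : H →L[ℂ] H) (x : H) :
    (E + F).reApplyInnerSelf x = E.reApplyInnerSelf x + F.reApplyInnerSelf x := by
  simp [ContinuousLinearMap.reApplyInnerSelf_apply, inner_add_left]

theorem reApplyInnerSelf_real_smul (r : ℝ) (E : H →L[ℂ] H) (x : H) :
    (r • E).reApplyInnerSelf x = r * E.reApplyInnerSelf x := by
  simp only [ContinuousLinearMap.reApplyInnerSelf_apply, smul_apply]
  rw [← Complex.coe_smul, inner_smul_left]
  simp

theorem reApplyInnerSelf_sum {ι : Type*} (s : Finset ι) (E : ι → H →L[ℂ] H) (x : H) :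
    (∑ i ∈ s, E i).reApplyInnerSelf x = ∑ i ∈ s, (E i).reApplyInnerSelf x := by
  simp [ContinuousLinearMap.reApplyInnerSelf_apply, sum_inner]

theorem reApplyInnerSelf_one (x : H) : (1 : H →L[ℂ] H).reApplyInnerSelf x = ‖x‖ ^ 2 := by
  rw [ContinuousLinearMap.reApplyInnerSelf_apply, one_apply_eq_self,
    inner_self_eq_norm_sq]

theorem reApplyInnerSelf_mono {E F : H →L[ℂ] H} (h : E ≤ F) (x : H) :
    E.reApplyInnerSelf x ≤ F.reApplyInnerSelf x := by
  have := ((ContinuousLinearMap.le_def E F).mp h).2 x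
  have h2 := reApplyInnerSelf_add (F - E) E x
  rw [sub_add_cancel] at h2
  linarith

/-- If `E = R²` with `R` self-adjoint, the form of `E` is `⟨R x, R y⟩`. -/
theorem inner_mul_self_apply [CompleteSpace H] {E R : H →L[ℂ] H} (hR : IsSelfAdjoint R)
    (h : R * R = E) (x y : H) :
    inner ℂ (E x) y = inner ℂ (R x) (R y) := by
  rw [← h, mul_apply_eq_comp, ← ContinuousLinearMap.adjoint_inner_right,
    ← ContinuousLinearMap.star_eq_adjoint, hR.star_eq]

/-- Cauchy–Schwarz for the form of a positive operator. -/
theorem isPosBlock_self [CompleteSpace H] {E : H →L[ℂ] H} (hE : 0 ≤ E) : IsPosBlock E E E := by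
  intro x y
  have hs : IsSelfAdjoint (CFC.sqrt E) := (CFC.sqrt_nonneg E).isSelfAdjoint
  have hm := CFC.sqrt_mul_sqrt_self E hE
  simp only [ContinuousLinearMap.reApplyInnerSelf_apply, inner_mul_self_apply hs hm,
    inner_self_eq_norm_sq]
  have := norm_inner_le_norm (𝕜 := ℂ) (CFC.sqrt E x) (CFC.sqrt E y)
  nlinarith [sq_nonneg (‖CFC.sqrt E x‖ - ‖CFC.sqrt E y‖)]

namespace IsPosBlock

variable {P Q T P' Q' T' : H →L[ℂ] H}

theorem smul_of_norm_le_one (h : IsPosBlock P Q T) {z : ℂ} (hz : ‖z‖ ≤ 1) :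
    IsPosBlock P Q (z • T) := by
  intro x y
  refine le_trans ?_ (h x y)
  rw [smul_apply, inner_smul_left, norm_mul, RCLike.norm_conj]
  have := norm_nonneg (inner ℂ (T x) y)
  nlinarith

theorem sum {ι : Type*} (s : Finset ι) {P Q T : ι → H →L[ℂ] H}
    (h : ∀ i ∈ s, IsPosBlock (P i) (Q i) (T i)) :
    IsPosBlock (∑ i ∈ s, P i) (∑ i ∈ s, Q i) (∑ i ∈ s, T i) := by
  intro x y
  rw [reApplyInnerSelf_sum, reApplyInnerSelf_sum, ← Finset.sum_add_distrib,
    sum_apply, sum_inner]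
  calc 2 * ‖∑ i ∈ s, inner ℂ (T i x) y‖ ≤ 2 * ∑ i ∈ s, ‖inner ℂ (T i x) y‖ := by
        gcongr; exact norm_sum_le _ _
    _ = ∑ i ∈ s, 2 * ‖inner ℂ (T i x) y‖ := Finset.mul_sum _ _ _
    _ ≤ _ := Finset.sum_le_sum fun i hi => h i hi x y

theorem real_smul (h : IsPosBlock P Q T) {r : ℝ} (hr : 0 ≤ r) :
    IsPosBlock (r • P) (r • Q) (r • T) := by
  intro x y
  rw [reApplyInnerSelf_real_smul, reApplyInnerSelf_real_smul, smul_apply,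
    ← Complex.coe_smul, inner_smul_left, norm_mul, RCLike.norm_conj, Complex.norm_real,
    Real.norm_of_nonneg hr]
  have := mul_le_mul_of_nonneg_left (h x y) hr
  linarith

theorem mono (h : IsPosBlock P Q T) (hP : P ≤ P') (hQ : Q ≤ Q') : IsPosBlock P' Q' T :=
  fun x y => (h x y).trans (add_le_add (reApplyInnerSelf_mono hP x) (reApplyInnerSelf_mono hQ y))

theorem of_tendsto {ι : Type*} {l : Filter ι} [l.NeBot] {p q t : ι → H →L[ℂ] H}
    (hp : Tendsto p l (𝓝 P)) (hq : Tendsto q l (𝓝 Q)) (ht : Tendsto t l (𝓝 T))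
    (h : ∀ᶠ i in l, IsPosBlock (p i) (q i) (t i)) : IsPosBlock P Q T := by
  intro x y
  have key : ∀ {e : ι → H →L[ℂ] H} {E : H →L[ℂ] H}, Tendsto e l (𝓝 E) → ∀ z w : H,
      Tendsto (fun i => inner ℂ (e i z) w) l (𝓝 (inner ℂ (E z) w)) := by
    intro e E he z w
    exact (((ContinuousLinearMap.apply ℂ H z).continuous.tendsto E).comp he).inner
      tendsto_const_nhds
  have hre : ∀ {e : ι → H →L[ℂ] H} {E : H →L[ℂ] H}, Tendsto e l (𝓝 E) → ∀ z : H,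
      Tendsto (fun i => (e i).reApplyInnerSelf z) l (𝓝 (E.reApplyInnerSelf z)) := fun he z =>
    (Complex.continuous_re.tendsto _).comp (key he z z)
  exact le_of_tendsto_of_tendsto ((key ht x y).norm.const_mul 2) ((hre hp x).add (hre hq y))
    (h.mono fun i hi => hi x y)

end IsPosBlock

end BlockPositivity

/-! ### The operator-valued Poisson kernel -/

section Poisson

variable {A : Type*} [CStarAlgebra A]

/-- The operator-valued Poisson kernel `(1 - Z)⁻¹ + ((1 - Z)⁻¹)⋆ - 1`. It is used for `‖Z‖ < 1`
only, where `1 - Z` is invertible and `Ring.inverse` is its true inverse. -/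
noncomputable def operatorPoissonKernel (Z : A) : A :=
  Ring.inverse (1 - Z) + star (Ring.inverse (1 - Z)) - 1

/-- With `R = (1 - Z)⁻¹` the Poisson kernel factors as `R (1 - Z Z⋆) R⋆`. -/
theorem operatorPoissonKernel_nonneg [PartialOrder A] [StarOrderedRing A] {Z : A} (hZ : ‖Z‖ < 1) :
    0 ≤ operatorPoissonKernel Z := by
  have hu : IsUnit (1 - Z) := isUnit_one_sub_of_norm_lt_one hZ
  have h1 : Ring.inverse (1 - Z) * (1 - Z) = 1 := Ring.inverse_mul_cancel _ hu
  have h2 : star (1 - Z) * star (Ring.inverse (1 - Z)) = 1 := by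
    rw [← star_mul, h1, star_one]
  have hfac : operatorPoissonKernel Z =
      Ring.inverse (1 - Z) * (1 - Z * star Z) * star (Ring.inverse (1 - Z)) := by
    rw [operatorPoissonKernel]
    set R := Ring.inverse (1 - Z)
    have e : 1 - Z * star Z = star (1 - Z) + (1 - Z) - (1 - Z) * star (1 - Z) := by
      rw [star_sub, star_one]; noncomm_ring
    calc R + star R - 1 = R * (star (1 - Z) * star R) + (R * (1 - Z)) * star R
          - (R * (1 - Z)) * (star (1 - Z) * star R) := by rw [h1, h2]; simp
      _ = _ := by rw [e]; noncomm_ring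
  rw [hfac]
  refine star_right_conjugate_nonneg ?_ _
  rw [sub_nonneg, ← CStarAlgebra.norm_le_one_iff_of_nonneg (Z * star Z) (mul_star_self_nonneg Z),
    CStarRing.norm_self_mul_star]
  nlinarith [norm_nonneg Z]

theorem IsPrimitiveRoot.sum_pow_mul_eq {N : ℕ} {μ : ℂ} (hμ : IsPrimitiveRoot μ N) (n : ℕ) :
    ∑ j ∈ Finset.range N, μ ^ (j * n) = if N ∣ n then (N : ℂ) else 0 := by
  simp_rw [mul_comm _ n, pow_mul]
  split_ifs with h
  · simp [(hμ.pow_eq_one_iff_dvd n).mpr h]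
  · have h1 : μ ^ n ≠ 1 := fun e => h ((hμ.pow_eq_one_iff_dvd n).mp e)
    have h2 := mul_neg_geom_sum (μ ^ n) N
    rw [← pow_mul, mul_comm n, pow_mul, hμ.pow_eq_one, one_pow, sub_self] at h2
    exact (mul_eq_zero.mp h2).resolve_left (sub_ne_zero.mpr h1.symm)

/-- The resolvent at an `N`-th root of unity is a finite geometric sum times `(1 - c ^ N)⁻¹`. -/
theorem inverse_one_sub_smul_eq {c : A} (hc : ‖c‖ < 1) {N : ℕ} (hN : N ≠ 0) {z : ℂ}
    (hz : z ^ N = 1) :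
    Ring.inverse (1 - z • c) =
      ∑ k ∈ Finset.range N, z ^ k • (c ^ k * Ring.inverse (1 - c ^ N)) := by
  have hz1 : ‖z‖ = 1 := Complex.norm_eq_one_of_pow_eq_one hz hN
  have hu : IsUnit (1 - z • c) :=
    isUnit_one_sub_of_norm_lt_one (by rwa [norm_smul, hz1, one_mul])
  have hcN : IsUnit (1 - c ^ N) := isUnit_one_sub_of_norm_lt_one
    (by
      refine (norm_pow_le' c (Nat.pos_of_ne_zero hN)).trans_lt ?_
      exact pow_lt_one₀ (norm_nonneg c) hc hN)
  have h := mul_neg_geom_sum (z • c) N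
  rw [smul_pow, hz, one_smul] at h
  have h3 : (∑ k ∈ Finset.range N, (z • c) ^ k) = Ring.inverse (1 - z • c) * (1 - c ^ N) := by
    rw [← h, ← mul_assoc, Ring.inverse_mul_cancel _ hu, one_mul]
  calc Ring.inverse (1 - z • c)
      = Ring.inverse (1 - z • c) * (1 - c ^ N) * Ring.inverse (1 - c ^ N) := by
        rw [mul_assoc, Ring.mul_inverse_cancel _ hcN, mul_one]
    _ = _ := by
        rw [← h3, Finset.sum_mul]
        exact Finset.sum_congr rfl fun k _ => by rw [smul_pow, smul_mul_assoc]

/-- Averaging the resolvents against a character of the `N`-th roots of unity singles out one power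
of `c`. -/
theorem sum_smul_inverse_one_sub {c : A} (hc : ‖c‖ < 1) {N : ℕ} {μ : ℂ}
    (hμ : IsPrimitiveRoot μ N) {m k₀ : ℕ} (hk₀ : k₀ < N) (hdvd : N ∣ k₀ + m) :
    ∑ j ∈ Finset.range N, μ ^ (j * m) • Ring.inverse (1 - μ ^ j • c) =
      (N : ℂ) • (c ^ k₀ * Ring.inverse (1 - c ^ N)) := by
  have hN : N ≠ 0 := by omega
  have hroot : ∀ j, (μ ^ j) ^ N = 1 := fun j => by rw [← pow_mul, mul_comm, pow_mul,
    hμ.pow_eq_one, one_pow]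
  simp_rw [inverse_one_sub_smul_eq hc hN (hroot _), Finset.smul_sum, smul_smul, ← pow_mul,
    ← pow_add, ← mul_add]
  rw [Finset.sum_comm]
  simp_rw [← Finset.sum_smul, hμ.sum_pow_mul_eq]
  rw [Finset.sum_eq_single k₀]
  · rw [add_comm, if_pos hdvd]
  · intro k hk hne
    rw [if_neg, zero_smul]
    intro hd
    rw [Finset.mem_range] at hk
    have h1 : (k : ℤ) - k₀ = ((m + k : ℕ) : ℤ) - ((k₀ + m : ℕ) : ℤ) := by push_cast; ring
    have h2 : (N : ℤ) ∣ (k : ℤ) - k₀ := by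
      rw [h1]; exact dvd_sub (Int.natCast_dvd_natCast.mpr hd) (Int.natCast_dvd_natCast.mpr hdvd)
    obtain ⟨q, hq⟩ := h2
    have : q = 0 := by
      by_contra hq0
      rcases lt_or_gt_of_ne hq0 with h | h <;> nlinarith
    subst this
    omega
  · intro h; exact absurd (Finset.mem_range.mpr hk₀) h

end Poisson

/-! ### Positive maps on blocks of contractions -/

section PositiveMap

variable {A : Type*} [CStarAlgebra A] [PartialOrder A] [StarOrderedRing A]
  {H : Type*} [NormedAddCommGroup H] [InnerProductSpace ℂ H] [CompleteSpace H]

/-- The blocks `[[Ψ E, conj λ Ψ E], [λ Ψ E, Ψ E]]`, with `E` the Poisson kernel of `c` at an `N`-th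
root of unity `λ`, have this block as their average. -/
theorem isPosBlock_poisson_average (Ψ : A →ₚ[ℂ] (H →L[ℂ] H)) {c : A} (hc : ‖c‖ < 1) {N : ℕ}
    (hN : 2 ≤ N) :
    IsPosBlock
      (Ψ (Ring.inverse (1 - c ^ N) + star (Ring.inverse (1 - c ^ N)) - 1))
      (Ψ (Ring.inverse (1 - c ^ N) + star (Ring.inverse (1 - c ^ N)) - 1))
      (Ψ (c * Ring.inverse (1 - c ^ N) +
        star (c ^ (N - 1) * Ring.inverse (1 - c ^ N)))) := by
  have hN0 : N ≠ 0 := by omega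
  have hNc : (N : ℂ) ≠ 0 := Nat.cast_ne_zero.mpr hN0
  set D := Ring.inverse (1 - c ^ N) with hD
  obtain ⟨μ, hμ⟩ : ∃ μ : ℂ, IsPrimitiveRoot μ N := ⟨_, Complex.isPrimitiveRoot_exp N hN0⟩
  have hμ1 : ‖μ‖ = 1 := hμ.norm'_eq_one hN0
  -- The kernel of `c` at `λ` is that of `conj λ • c`; with `conj λ = μ ^ j` the weight `λ` is
  -- `μ ^ (j * (N - 1))`.
  have hstar : ∀ j : ℕ, star (μ ^ j) = μ ^ (j * (N - 1)) := by
    intro j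
    have h1 : (star μ) * μ = 1 := by
      rw [Complex.star_def, Complex.conj_mul', hμ1]; simp
    have h2 : μ ^ (N - 1) * μ = 1 := by
      rw [← pow_succ, Nat.sub_add_cancel (by omega), hμ.pow_eq_one]
    rw [star_pow, mul_comm, pow_mul, mul_right_cancel₀ (hμ.ne_zero hN0) (h1.trans h2.symm)]
  let E : ℕ → A := fun j => operatorPoissonKernel (μ ^ j • c)
  have hE : ∀ j, 0 ≤ E j := fun j => operatorPoissonKernel_nonneg (by
    rw [norm_smul, norm_pow, hμ1, one_pow, one_mul]; exact hc)
  have hblock : IsPosBlock (∑ j ∈ Finset.range N, Ψ (E j)) (∑ j ∈ Finset.range N, Ψ (E j))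
      (∑ j ∈ Finset.range N, μ ^ (j * (N - 1)) • Ψ (E j)) :=
    IsPosBlock.sum _ fun j _ => (isPosBlock_self (Ψ.map_nonneg (hE j))).smul_of_norm_le_one
      (by rw [norm_pow, hμ1, one_pow])
  have s0 := sum_smul_inverse_one_sub hc hμ (m := 0) (k₀ := 0) (by omega) (by simp)
  have s1 := sum_smul_inverse_one_sub hc hμ (m := N - 1) (k₀ := 1) (by omega)
    (by rw [Nat.add_sub_cancel' (by omega)])
  have s2 := sum_smul_inverse_one_sub hc hμ (m := 1) (k₀ := N - 1) (by omega)
    (by rw [Nat.sub_add_cancel (by omega)])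
  rw [← hD] at s0 s1 s2
  simp only [mul_zero, pow_zero, one_smul, one_mul, mul_one, pow_one] at s0 s1 s2
  have sumE : ∑ j ∈ Finset.range N, E j = (N : ℂ) • (D + star D - 1) := by
    simp only [E, operatorPoissonKernel, Finset.sum_sub_distrib, Finset.sum_add_distrib,
      ← star_sum, s0]
    rw [star_smul, smul_sub, smul_add]
    simp [Nat.cast_smul_eq_nsmul]
  have sumE' : ∑ j ∈ Finset.range N, μ ^ (j * (N - 1)) • E j =
      (N : ℂ) • (c * D + star (c ^ (N - 1) * D)) := by
    have s3 : ∑ j ∈ Finset.range N, μ ^ (j * (N - 1)) • star (Ring.inverse (1 - μ ^ j • c)) =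
        (N : ℂ) • star (c ^ (N - 1) * D) := by
      simp_rw [← hstar, ← star_smul]
      rw [← star_sum, s2, star_smul]
      simp
    have s4 : ∑ j ∈ Finset.range N, μ ^ (j * (N - 1)) • (1 : A) = 0 := by
      rw [← Finset.sum_smul, hμ.sum_pow_mul_eq, if_neg, zero_smul]
      intro h
      have := Nat.le_of_dvd (by omega) h
      omega
    simp only [E, operatorPoissonKernel, smul_sub, smul_add, Finset.sum_sub_distrib,
      Finset.sum_add_distrib, s1, s3, s4, sub_zero]
  simp only [← map_smul, ← map_sum, sumE, sumE'] at hblock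
  have := hblock.real_smul (r := (N : ℝ)⁻¹) (by positivity)
  have hcancel : ∀ a : A, (N : ℝ)⁻¹ • Ψ ((N : ℂ) • a) = Ψ a := by
    intro a
    rw [map_smul, ← Complex.coe_smul, smul_smul]
    simp [hNc]
  simpa only [hcancel] using this

/-- A positive map `Ψ` sends the positive block `[[1, c⋆], [c, 1]]` of a contraction `c` to a
positive block, although `Ψ` need not be `2`-positive. -/
theorem isPosBlock_map_of_norm_lt_one (Ψ : A →ₚ[ℂ] (H →L[ℂ] H)) {c : A} (hc : ‖c‖ < 1) :
    IsPosBlock (Ψ 1) (Ψ 1) (Ψ c) := by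
  have hpow : Tendsto (fun N : ℕ => c ^ N) atTop (𝓝 0) :=
    tendsto_pow_atTop_nhds_zero_of_norm_lt_one hc
  have hD : Tendsto (fun N : ℕ => Ring.inverse (1 - c ^ N)) atTop (𝓝 1) := by
    have h1 : Tendsto (fun N : ℕ => 1 - c ^ N) atTop (𝓝 ((1 : Aˣ) : A)) := by
      simpa using hpow.const_sub 1
    simpa [Function.comp_def] using (NormedRing.inverse_continuousAt (1 : Aˣ)).tendsto.comp h1
  have hs : Tendsto (fun N : ℕ => star (Ring.inverse (1 - c ^ N))) atTop (𝓝 1) := by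
    simpa [Function.comp_def] using (continuous_star.tendsto (1 : A)).comp hD
  have ha : Tendsto (fun N : ℕ => Ψ (Ring.inverse (1 - c ^ N) +
      star (Ring.inverse (1 - c ^ N)) - 1)) atTop (𝓝 (Ψ 1)) := by
    refine ((map_continuous Ψ).tendsto 1).comp ?_
    simpa using (hD.add hs).sub_const 1
  have hb : Tendsto (fun N : ℕ => Ψ (c * Ring.inverse (1 - c ^ N) +
      star (c ^ (N - 1) * Ring.inverse (1 - c ^ N)))) atTop (𝓝 (Ψ c)) := by
    refine ((map_continuous Ψ).tendsto c).comp ?_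
    have h1 : Tendsto (fun N : ℕ => c ^ (N - 1) * Ring.inverse (1 - c ^ N)) atTop (𝓝 0) := by
      simpa using (hpow.comp (tendsto_sub_atTop_nat 1)).mul hD
    have h2 := (continuous_star.tendsto (0 : A)).comp h1
    simpa using (hD.const_mul c).add h2
  exact IsPosBlock.of_tendsto ha ha hb
    (eventually_atTop.mpr ⟨2, fun N hN => isPosBlock_poisson_average Ψ hc hN⟩)

theorem isPosBlock_map_of_norm_le_one (Ψ : A →ₚ[ℂ] (H →L[ℂ] H)) {c : A} (hc : ‖c‖ ≤ 1) :
    IsPosBlock (Ψ 1) (Ψ 1) (Ψ c) := by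
  have ht : Tendsto (fun t : ℝ => t • c) (𝓝[<] 1) (𝓝 c) := by
    have : Tendsto (fun t : ℝ => t • c) (𝓝 1) (𝓝 ((1 : ℝ) • c)) :=
      (continuous_id.smul continuous_const).tendsto 1
    rw [one_smul] at this
    exact this.mono_left nhdsWithin_le_nhds
  refine IsPosBlock.of_tendsto tendsto_const_nhds tendsto_const_nhds
    (((map_continuous Ψ).tendsto c).comp ht) ?_
  filter_upwards [Ioo_mem_nhdsLT (zero_lt_one' ℝ)] with t ht
  refine isPosBlock_map_of_norm_lt_one Ψ ?_
  rw [norm_smul, Real.norm_of_nonneg ht.1.le]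
  nlinarith [ht.1, ht.2, norm_nonneg c]

end PositiveMap

/-! ### Polar decomposition -/

section Polar

variable {H : Type*} [NormedAddCommGroup H] [InnerProductSpace ℂ H] [CompleteSpace H]

theorem norm_cfcAbs_apply (T : H →L[ℂ] H) (x : H) : ‖CFC.abs T x‖ = ‖T x‖ := by
  have h1 : inner ℂ ((star T * T) x) x = inner ℂ (CFC.abs T x) (CFC.abs T x) :=
    inner_mul_self_apply (CFC.abs_nonneg T).isSelfAdjoint (CFC.abs_mul_abs T) x x
  rw [mul_apply_eq_comp, ContinuousLinearMap.star_eq_adjoint,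
    ContinuousLinearMap.adjoint_inner_left, inner_self_eq_norm_sq_to_K,
    inner_self_eq_norm_sq_to_K] at h1
  have h2 : ‖T x‖ ^ 2 = ‖CFC.abs T x‖ ^ 2 := by exact_mod_cast h1
  exact ((sq_eq_sq₀ (norm_nonneg _) (norm_nonneg _)).mp h2).symm

/-- Polar decomposition: `|T| = V T`, with `V` the adjoint of the isometry `|T| x ↦ T x` from the
closure of the range of `|T|`, extended by zero to the orthogonal complement. -/
theorem exists_isPartialIsometry_mul_eq_cfcAbs (T : H →L[ℂ] H) :
    ∃ V : H →L[ℂ] H, IsPartialIsometry V ∧ V * T = CFC.abs T := by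
  let P : H →L[ℂ] H := CFC.abs T
  let K : Submodule ℂ H := (LinearMap.range (P : H →ₗ[ℂ] H)).topologicalClosure
  have : CompleteSpace K :=
    (Submodule.isClosed_topologicalClosure _).completeSpace_coe
  have hmem : ∀ x, P x ∈ K := fun x => Submodule.le_topologicalClosure _ ⟨x, rfl⟩
  let e : H →ₗ[ℂ] K := (P : H →ₗ[ℂ] H).codRestrict K hmem
  have he : ∀ x, ((e x : K) : H) = P x := fun x => rfl
  have hdense : DenseRange e := by
    intro k
    rw [Metric.mem_closure_iff]
    intro ε hε
    obtain ⟨_, ⟨x, rfl⟩, hx⟩ := Metric.mem_closure_iff.mp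
      (show (k : H) ∈ closure (LinearMap.range (P : H →ₗ[ℂ] H) : Set H) from k.2) ε hε
    exact ⟨e x, ⟨x, rfl⟩, hx⟩
  have hbound : ∀ x, ‖(T : H →ₗ[ℂ] H) x‖ ≤ 1 * ‖e x‖ := by
    intro x
    rw [one_mul]
    exact (norm_cfcAbs_apply T x).ge
  let U : K →L[ℂ] H := (T : H →ₗ[ℂ] H).extendOfNorm e
  have hU : ∀ x, U (e x) = T x := fun x => LinearMap.extendOfNorm_eq hdense ⟨1, hbound⟩ x
  have hnorm : ∀ k : K, ‖U k‖ = ‖k‖ := by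
    intro k
    refine hdense.induction (P := fun k => ‖U k‖ = ‖k‖) ?_
      (isClosed_eq (by fun_prop) (by fun_prop)) k
    rintro _ ⟨x, rfl⟩
    rw [hU]
    exact (norm_cfcAbs_apply T x).symm
  have hinner : ∀ k l : K, inner ℂ (U k) (U l) = inner ℂ k l :=
    (LinearMap.norm_map_iff_inner_map_map U).mp hnorm
  let W : H →L[ℂ] H := U ∘L K.orthogonalProjectionOnto
  have hWW : star W * W = K.starProjection := by
    refine ContinuousLinearMap.ext fun x => ext_inner_right ℂ fun y => ?_
    rw [mul_apply_eq_comp, ContinuousLinearMap.star_eq_adjoint,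
      ContinuousLinearMap.adjoint_inner_left]
    change inner ℂ (U (K.orthogonalProjectionOnto x)) (U (K.orthogonalProjectionOnto y)) = _
    rw [hinner]
    exact (K.inner_orthogonalProjectionOnto_eq_of_mem_left _ y)
  have hWP : W * P = T := by
    ext x
    change U (K.orthogonalProjectionOnto (P x)) = T x
    have : K.orthogonalProjectionOnto (P x) = e x :=
      K.orthogonalProjectionOnto_mem_subspace_eq_self (e x)
    rw [this, hU]
  have hWK : W * K.starProjection = W := by
    ext x
    change U (K.orthogonalProjectionOnto (K.starProjection x)) = U (K.orthogonalProjectionOnto x)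
    congr 1
    exact K.orthogonalProjectionOnto_mem_subspace_eq_self (K.orthogonalProjectionOnto x)
  refine ⟨star W, ?_, ?_⟩
  · have h1 : W * star W * W = W := by rw [mul_assoc, hWW, hWK]
    have h2 := congrArg star h1
    rw [star_mul, star_mul, ← mul_assoc] at h2
    exact h2
  · calc star W * T = star W * W * P := by rw [mul_assoc, hWP]
      _ = P := by
        rw [hWW]
        ext x
        exact Submodule.starProjection_eq_self_iff.mpr (hmem x)

end Polar

/-! ### The geometric mean and its extremal property -/

section GeometricMean

variable {H : Type*} [NormedAddCommGroup H] [InnerProductSpace ℂ H] [CompleteSpace H]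

theorem reApplyInnerSelf_conj (R P : H →L[ℂ] H) (x : H) :
    (star R * P * R).reApplyInnerSelf x = P.reApplyInnerSelf (R x) := by
  simp only [ContinuousLinearMap.reApplyInnerSelf_apply, mul_apply_eq_comp,
    ContinuousLinearMap.star_eq_adjoint, ContinuousLinearMap.adjoint_inner_left]

theorem IsPosBlock.conj {P Q T : H →L[ℂ] H} (h : IsPosBlock P Q T) (R S : H →L[ℂ] H) :
    IsPosBlock (star R * P * R) (star S * Q * S) (star S * T * R) := by
  intro x y
  rw [reApplyInnerSelf_conj, reApplyInnerSelf_conj]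
  simpa only [mul_apply_eq_comp, ContinuousLinearMap.star_eq_adjoint,
    ContinuousLinearMap.adjoint_inner_left] using h (R x) (S y)

theorem reApplyInnerSelf_mul_self {Y : H →L[ℂ] H} (hY : IsSelfAdjoint Y) (x : H) :
    (Y * Y).reApplyInnerSelf x = ‖Y x‖ ^ 2 := by
  rw [ContinuousLinearMap.reApplyInnerSelf_apply, inner_mul_self_apply hY rfl,
    inner_self_eq_norm_sq]

/-- The case `P = 1` of the Schur complement criterion. -/
theorem IsPosBlock.mul_self_le {K Y : H →L[ℂ] H} (hK : IsSelfAdjoint K) (hY : IsSelfAdjoint Y)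
    (h : IsPosBlock 1 K Y) : Y * Y ≤ K := by
  rw [ContinuousLinearMap.le_def, ContinuousLinearMap.isPositive_def']
  refine ⟨hK.sub (by rw [← sq]; exact hY.pow 2), fun y => ?_⟩
  -- The choice `x = Y y` makes both `2 ‖⟨Y x, y⟩‖` and the diagonal term `‖x‖²` multiples of
  -- `‖Y y‖²`.
  have h1 := h (Y y) y
  have h2 := reApplyInnerSelf_add (K - Y * Y) (Y * Y) y
  have h3 : inner ℂ (Y (Y y)) y = inner ℂ (Y y) (Y y) := by
    rw [← mul_apply_eq_comp, inner_mul_self_apply hY rfl]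
  rw [sub_add_cancel, reApplyInnerSelf_mul_self hY] at h2
  rw [h3, reApplyInnerSelf_one, inner_self_eq_norm_sq_to_K] at h1
  simp only [norm_pow, Complex.coe_algebraMap, Complex.norm_real, norm_norm] at h1
  linarith

theorem isPosBlock_one_sqrt {K : H →L[ℂ] H} (hK : 0 ≤ K) : IsPosBlock 1 K (CFC.sqrt K) := by
  intro x y
  have hs : IsSelfAdjoint (CFC.sqrt K) := (CFC.sqrt_nonneg K).isSelfAdjoint
  have h1 : K.reApplyInnerSelf y = ‖CFC.sqrt K y‖ ^ 2 := by
    rw [← reApplyInnerSelf_mul_self hs, CFC.sqrt_mul_sqrt_self K hK]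
  have h2 : inner ℂ (CFC.sqrt K x) y = inner ℂ x (CFC.sqrt K y) := by
    rw [← ContinuousLinearMap.adjoint_inner_right, ← ContinuousLinearMap.star_eq_adjoint,
      hs.star_eq]
  rw [h1, h2, reApplyInnerSelf_one]
  have := norm_inner_le_norm (𝕜 := ℂ) x (CFC.sqrt K y)
  nlinarith [sq_nonneg (‖x‖ - ‖CFC.sqrt K y‖)]

theorem rpow_half_mul_rpow_half {P : H →L[ℂ] H} (hP : IsStrictlyPositive P) :
    P ^ (1 / 2 : ℝ) * P ^ (1 / 2 : ℝ) = P := by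
  rw [← CFC.rpow_add hP.isUnit]
  norm_num
  exact CFC.rpow_one P hP.nonneg

theorem rpow_half_mul_rpow_neg_half {P : H →L[ℂ] H} (hP : IsStrictlyPositive P) :
    P ^ (1 / 2 : ℝ) * P ^ (-1 / 2 : ℝ) = 1 := by
  rw [← CFC.rpow_add hP.isUnit]
  norm_num
  exact CFC.rpow_zero P hP.nonneg

theorem rpow_neg_half_mul_rpow_half {P : H →L[ℂ] H} (hP : IsStrictlyPositive P) :
    P ^ (-1 / 2 : ℝ) * P ^ (1 / 2 : ℝ) = 1 := by
  rw [← CFC.rpow_add hP.isUnit]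
  norm_num
  exact CFC.rpow_zero P hP.nonneg

/-- The mean `G = P # Q` makes the block `[[P, G], [G, Q]]` positive. -/
theorem isPosBlock_geomMeanOfInvertible {P Q : H →L[ℂ] H} (hP : IsStrictlyPositive P)
    (hQ : 0 ≤ Q) : IsPosBlock P Q (geomMeanOfInvertible P Q) := by
  have ha : IsSelfAdjoint (P ^ (1 / 2 : ℝ)) := CFC.rpow_nonneg.isSelfAdjoint
  have ha' : IsSelfAdjoint (P ^ (-1 / 2 : ℝ)) := CFC.rpow_nonneg.isSelfAdjoint
  have hK : 0 ≤ P ^ (-1 / 2 : ℝ) * Q * P ^ (-1 / 2 : ℝ) := ha'.conjugate_nonneg hQ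
  have h := (isPosBlock_one_sqrt hK).conj (P ^ (1 / 2 : ℝ)) (P ^ (1 / 2 : ℝ))
  have e : P ^ (1 / 2 : ℝ) * (P ^ (-1 / 2 : ℝ) * Q * P ^ (-1 / 2 : ℝ)) * P ^ (1 / 2 : ℝ) = Q := by
    rw [mul_assoc, mul_assoc, rpow_neg_half_mul_rpow_half hP, mul_one, ← mul_assoc,
      rpow_half_mul_rpow_neg_half hP, one_mul]
  rw [ha.star_eq, mul_one, rpow_half_mul_rpow_half hP, e, CFC.sqrt_eq_rpow] at h
  exact h

/-- The mean `P # Q` dominates every positive `X` with `[[P, X], [X, Q]]` positive: conjugation by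
`P^{-1/2}` reduces this to `P = 1`, where it is the operator monotonicity of the square root. -/
theorem IsPosBlock.le_geomMeanOfInvertible {P Q X : H →L[ℂ] H} (h : IsPosBlock P Q X)
    (hP : IsStrictlyPositive P) (hQ : 0 ≤ Q) (hX : 0 ≤ X) : X ≤ geomMeanOfInvertible P Q := by
  have ha : IsSelfAdjoint (P ^ (1 / 2 : ℝ)) := CFC.rpow_nonneg.isSelfAdjoint
  have ha' : IsSelfAdjoint (P ^ (-1 / 2 : ℝ)) := CFC.rpow_nonneg.isSelfAdjoint
  have hK : 0 ≤ P ^ (-1 / 2 : ℝ) * Q * P ^ (-1 / 2 : ℝ) := ha'.conjugate_nonneg hQ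
  have hY : 0 ≤ P ^ (-1 / 2 : ℝ) * X * P ^ (-1 / 2 : ℝ) := ha'.conjugate_nonneg hX
  have h1 := h.conj (P ^ (-1 / 2 : ℝ)) (P ^ (-1 / 2 : ℝ))
  have e1 : P ^ (-1 / 2 : ℝ) * P * P ^ (-1 / 2 : ℝ) = 1 := by
    nth_rewrite 2 [← rpow_half_mul_rpow_half hP]
    rw [← mul_assoc, rpow_neg_half_mul_rpow_half hP, one_mul, rpow_half_mul_rpow_neg_half hP]
  rw [ha'.star_eq, e1] at h1
  have h2 := CFC.sqrt_le_sqrt _ _ (h1.mul_self_le hK.isSelfAdjoint hY.isSelfAdjoint)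
  rw [CFC.sqrt_mul_self _ hY, CFC.sqrt_eq_rpow] at h2
  have h3 := ha.conjugate_le_conjugate h2
  have e2 : P ^ (1 / 2 : ℝ) * (P ^ (-1 / 2 : ℝ) * X * P ^ (-1 / 2 : ℝ)) * P ^ (1 / 2 : ℝ) = X := by
    rw [mul_assoc, mul_assoc, rpow_neg_half_mul_rpow_half hP, mul_one, ← mul_assoc,
      rpow_half_mul_rpow_neg_half hP, one_mul]
  rwa [e2] at h3

theorem norm_apply_sq_le_of_nonneg {D : H →L[ℂ] H} (hD : 0 ≤ D) (x : H) :
    ‖D x‖ ^ 2 ≤ ‖D‖ * D.reApplyInnerSelf x := by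
  have hs : IsSelfAdjoint (CFC.sqrt D) := (CFC.sqrt_nonneg D).isSelfAdjoint
  have hm : CFC.sqrt D * CFC.sqrt D = D := CFC.sqrt_mul_sqrt_self D hD
  have h1 : D.reApplyInnerSelf x = ‖CFC.sqrt D x‖ ^ 2 := by
    rw [← reApplyInnerSelf_mul_self hs, hm]
  have h2 : ‖D‖ = ‖CFC.sqrt D‖ ^ 2 := by
    rw [sq, ← CStarRing.norm_self_mul_star, hs.star_eq, hm]
  have h3 : D x = CFC.sqrt D (CFC.sqrt D x) := by rw [← mul_apply_eq_comp, hm]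
  rw [h1, h2, h3, ← mul_pow]
  exact pow_le_pow_left₀ (norm_nonneg _) (ContinuousLinearMap.le_opNorm _ _) 2

/-- Vigier's theorem: a family of positive operators that decreases as `r → 0⁺` converges in the
strong operator topology. -/
theorem exists_tendsto_of_monotoneOn {G : ℝ → H →L[ℂ] H} (hpos : ∀ r, 0 < r → 0 ≤ G r)
    (hmono : MonotoneOn G (Set.Ioi 0)) :
    ∃ L : H →L[ℂ] H, ∀ x, Tendsto (fun r => G r x) (𝓝[>] 0) (𝓝 (L x)) := by
  have hex : ∀ x, ∃ y, Tendsto (fun r => G r x) (𝓝[>] 0) (𝓝 y) := by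
    intro x
    rw [← cauchy_map_iff_exists_tendsto, Metric.cauchy_iff]
    refine ⟨inferInstance, fun ε hε => ?_⟩
    have hq : MonotoneOn (fun r => (G r).reApplyInnerSelf x) (Set.Ioi 0) :=
      fun r hr s hs hrs => reApplyInnerSelf_mono (hmono hr hs hrs) x
    have hbdd : BddBelow ((fun r => (G r).reApplyInnerSelf x) '' Set.Ioi 0) :=
      ⟨0, by rintro _ ⟨r, hr, rfl⟩; exact reApplyInnerSelf_nonneg (hpos r hr) x⟩
    have hlim := hq.tendsto_nhdsGT hbdd
    set q := sInf ((fun r => (G r).reApplyInnerSelf x) '' Set.Ioi 0)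
    have hη : 0 < ε ^ 2 / (‖G 1‖ + 1) := by positivity
    have hev : ∀ᶠ r in 𝓝[>] (0 : ℝ), (G r).reApplyInnerSelf x < q + ε ^ 2 / (‖G 1‖ + 1) :=
      hlim.eventually_lt_const (by linarith)
    obtain ⟨δ, hδ, hδ'⟩ := mem_nhdsGT_iff_exists_Ioo_subset.mp hev
    have hδ0 : (0 : ℝ) < δ := hδ
    -- Close to `0` the forms `⟨G r x, x⟩` are within `ε² / (‖G 1‖ + 1)` of their infimum, and
    -- `‖D x‖² ≤ ‖D‖ ⟨D x, x⟩` for `D = G s - G r` turns this into `‖D x‖ < ε`.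
    refine ⟨(fun r => G r x) '' Set.Ioo 0 (min δ 1),
      image_mem_map (Ioo_mem_nhdsGT (lt_min hδ0 one_pos)), ?_⟩
    have key : ∀ r ∈ Set.Ioo 0 (min δ 1), ∀ s ∈ Set.Ioo 0 (min δ 1), r ≤ s →
        dist (G r x) (G s x) < ε := by
      intro r hr s hs hrs
      have hD : 0 ≤ G s - G r := sub_nonneg.mpr (hmono hr.1 hs.1 hrs)
      have hD1 : G s - G r ≤ G 1 := by
        refine (sub_le_self _ (hpos r hr.1)).trans (hmono hs.1 (Set.mem_Ioi.mpr one_pos) ?_)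
        exact (hs.2.trans_le (min_le_right _ _)).le
      have hnorm : ‖G s - G r‖ ≤ ‖G 1‖ := CStarAlgebra.norm_le_norm_of_nonneg_of_le hD hD1
      have h1 := norm_apply_sq_le_of_nonneg hD x
      have h2 := reApplyInnerSelf_add (G s - G r) (G r) x
      rw [sub_add_cancel] at h2
      have h3 : (G s).reApplyInnerSelf x < q + ε ^ 2 / (‖G 1‖ + 1) :=
        hδ' ⟨hs.1, hs.2.trans_le (min_le_left _ _)⟩
      have h4 : q ≤ (G r).reApplyInnerSelf x := csInf_le hbdd ⟨r, hr.1, rfl⟩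
      have h5 := reApplyInnerSelf_nonneg hD x
      have h6 : (G s - G r).reApplyInnerSelf x < ε ^ 2 / (‖G 1‖ + 1) := by linarith
      rw [lt_div_iff₀ (by positivity)] at h6
      have h7 : ‖(G s - G r) x‖ ^ 2 < ε ^ 2 := by nlinarith
      rw [dist_comm, dist_eq_norm]
      exact lt_of_pow_lt_pow_left₀ 2 hε.le h7
    rintro _ ⟨r, hr, rfl⟩ _ ⟨s, hs, rfl⟩
    rcases le_total r s with h | h
    · exact key r hr s hs h
    · rw [dist_comm]; exact key s hs r hr h
  choose f hf using hex
  exact ⟨continuousLinearMapOfTendsto G (tendsto_pi_nhds.mpr hf), hf⟩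

/-- The mean of two positive operators exists, and dominates every positive `X` that makes
`[[P, X], [X, Q]]` positive. -/
theorem IsPosBlock.exists_isGeomMean_ge {P Q X : H →L[ℂ] H} (h : IsPosBlock P Q X)
    (hP : 0 ≤ P) (hQ : 0 ≤ Q) (hX : 0 ≤ X) : ∃ G, IsGeomMean P Q G ∧ X ≤ G := by
  have hsp : ∀ {R : H →L[ℂ] H}, 0 ≤ R → ∀ {r : ℝ}, 0 < r → IsStrictlyPositive (R + r • 1) := by
    intro R hR r hr
    exact IsStrictlyPositive.nonneg_add hR (IsStrictlyPositive.smul hr isStrictlyPositive_one)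
  have hle : ∀ (R : H →L[ℂ] H) {r s : ℝ}, r ≤ s → R + r • 1 ≤ R + s • 1 := fun R r s hrs =>
    add_le_add_right (smul_le_smul_of_nonneg_right hrs zero_le_one) R
  let G : ℝ → H →L[ℂ] H := fun r => geomMeanOfInvertible (P + r • 1) (Q + r • 1)
  have hG : ∀ r, 0 < r → 0 ≤ G r := fun r hr =>
    (CFC.rpow_nonneg.isSelfAdjoint).conjugate_nonneg CFC.rpow_nonneg
  have hmono : MonotoneOn G (Set.Ioi 0) := by
    intro r hr s hs hrs
    exact ((isPosBlock_geomMeanOfInvertible (hsp hP hr) (hsp hQ hr).nonneg).mono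
      (hle P hrs) (hle Q hrs)).le_geomMeanOfInvertible (hsp hP hs) (hsp hQ hs).nonneg (hG r hr)
  obtain ⟨L, hL⟩ := exists_tendsto_of_monotoneOn hG hmono
  refine ⟨L, hL, ?_⟩
  have hXG : ∀ r, 0 < r → X ≤ G r := fun r hr =>
    (h.mono (by simpa using hle P hr.le) (by simpa using hle Q hr.le)).le_geomMeanOfInvertible
      (hsp hP hr) (hsp hQ hr).nonneg hX
  rw [ContinuousLinearMap.le_def, ContinuousLinearMap.isPositive_iff_complex]
  have hinner : ∀ x, Tendsto (fun r => inner ℂ ((G r - X) x) x) (𝓝[>] 0)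
      (𝓝 (inner ℂ ((L - X) x) x)) := by
    intro x
    simp only [sub_apply]
    exact ((hL x).sub_const (X x)).inner tendsto_const_nhds
  have hev : ∀ x, ∀ᶠ r in 𝓝[>] (0 : ℝ), ((RCLike.re (inner ℂ ((G r - X) x) x) : ℝ) : ℂ) =
      inner ℂ ((G r - X) x) x ∧ 0 ≤ RCLike.re (inner ℂ ((G r - X) x) x) := by
    intro x
    filter_upwards [self_mem_nhdsWithin] with r hr
    exact (ContinuousLinearMap.isPositive_iff_complex _).mp
      ((ContinuousLinearMap.le_def _ _).mp (hXG r hr)) x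
  intro x
  have hre := (RCLike.continuous_re.tendsto _).comp (hinner x)
  refine ⟨tendsto_nhds_unique_of_eventuallyEq
    ((Complex.continuous_ofReal.tendsto _).comp hre) (hinner x) ((hev x).mono fun r hr => hr.1), ?_⟩
  exact ge_of_tendsto hre ((hev x).mono fun r hr => hr.2)

end GeometricMean

/-! ### Semi-hyponormal elements -/

section SemiHyponormal

variable {A : Type*} [CStarAlgebra A]

/-- An element intertwining two self-adjoint elements intertwines their continuous functional
calculi, by Weierstrass approximation. -/
theorem SemiconjBy.cfc_real {s a b : A} (h : SemiconjBy s a b) (ha : IsSelfAdjoint a)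
    (hb : IsSelfAdjoint b) {f : ℝ → ℝ} (hf : Continuous f) :
    SemiconjBy s (cfc f a) (cfc f b) := by
  obtain ⟨M, hM⟩ := ((spectrum.isCompact (𝕜 := ℝ) a).union
    (spectrum.isCompact (𝕜 := ℝ) b)).isBounded.subset_closedBall 0
  rw [Real.closedBall_eq_Icc] at hM
  have hpoly : ∀ p : Polynomial ℝ, s * Polynomial.aeval a p = Polynomial.aeval b p * s := by
    intro p
    induction p using Polynomial.induction_on' with
    | add p q hp hq => rw [map_add, map_add, mul_add, add_mul, hp, hq]
    | monomial n r =>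
      rw [Polynomial.aeval_monomial, Polynomial.aeval_monomial, ← mul_assoc,
        ← Algebra.commutes, mul_assoc, mul_assoc, (h.pow_right n).eq]
  have hclose : ∀ ε > 0, ‖s * cfc f a - cfc f b * s‖ ≤ 2 * ‖s‖ * ε := by
    intro ε hε
    obtain ⟨p, hp⟩ := exists_polynomial_near_of_continuousOn (0 - M) (0 + M) f hf.continuousOn ε hε
    have hnear : ∀ c : A, IsSelfAdjoint c → spectrum ℝ c ⊆ Set.Icc (0 - M) (0 + M) →
        ‖cfc f c - Polynomial.aeval c p‖ ≤ ε := by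
      intro c hc hsub
      rw [← cfc_polynomial p c, ← cfc_sub f p.eval c]
      refine norm_cfc_le hε.le fun x hx => ?_
      rw [Real.norm_eq_abs, abs_sub_comm]
      exact (hp x (hsub hx)).le
    have h1 := hnear a ha (Set.subset_union_left.trans hM)
    have h2 := hnear b hb (Set.subset_union_right.trans hM)
    have e : s * cfc f a - cfc f b * s =
        s * (cfc f a - Polynomial.aeval a p) - (cfc f b - Polynomial.aeval b p) * s := by
      rw [mul_sub, sub_mul, hpoly]; abel
    rw [e]
    calc _ ≤ ‖s‖ * ‖cfc f a - Polynomial.aeval a p‖ + ‖cfc f b - Polynomial.aeval b p‖ * ‖s‖ :=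
          (norm_sub_le _ _).trans (add_le_add (norm_mul_le _ _) (norm_mul_le _ _))
      _ ≤ ‖s‖ * ε + ε * ‖s‖ := by gcongr
      _ = _ := by ring
  have hlim : Tendsto (fun ε : ℝ => 2 * ‖s‖ * ε) (𝓝[>] 0) (𝓝 0) := by
    have : Tendsto (fun ε : ℝ => 2 * ‖s‖ * ε) (𝓝 0) (𝓝 (2 * ‖s‖ * 0)) :=
      tendsto_id.const_mul _
    rw [mul_zero] at this
    exact this.mono_left nhdsWithin_le_nhds
  have h0 : ‖s * cfc f a - cfc f b * s‖ ≤ 0 :=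
    ge_of_tendsto hlim (eventually_nhdsWithin_of_forall fun ε hε => hclose ε hε)
  exact sub_eq_zero.mp (norm_le_zero_iff.mp h0)

variable [PartialOrder A] [StarOrderedRing A]

theorem cfcAbs_eq_cfc_sqrt (S : A) : CFC.abs S = cfc Real.sqrt (star S * S) := by
  rw [CFC.abs, CFC.sqrt_eq_real_sqrt _ (star_mul_self_nonneg S), cfcₙ_eq_cfc]

theorem mul_cfcAbs_eq (S : A) : S * CFC.abs S = CFC.abs (star S) * S := by
  have h : SemiconjBy S (star S * S) (S * star S) := (mul_assoc S (star S) S).symm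
  have := h.cfc_real (.star_mul_self S) (.mul_star_self S) Real.continuous_sqrt
  rw [cfcAbs_eq_cfc_sqrt, cfcAbs_eq_cfc_sqrt, star_star]
  exact this

theorem isStrictlyPositive_cfcAbs_add (S : A) {r : ℝ} (hr : 0 < r) :
    IsStrictlyPositive (CFC.abs S + r • 1) :=
  IsStrictlyPositive.nonneg_add (CFC.abs_nonneg S)
    (IsStrictlyPositive.smul hr isStrictlyPositive_one)

/-- Since `S |S| = |S⋆| S`, the left-hand side is `|S⋆|² (|S⋆| + r)⁻¹`. -/
theorem mul_inverse_cfcAbs_add_mul_star_le (S : A) {r : ℝ} (hr : 0 < r) :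
    S * Ring.inverse (CFC.abs S + r • 1) * star S ≤ CFC.abs (star S) := by
  have hQ := isStrictlyPositive_cfcAbs_add S hr
  have hR := isStrictlyPositive_cfcAbs_add (star S) hr
  set T := CFC.abs (star S) with hT
  have hTT : T * T = S * star S := by rw [hT, CFC.abs_mul_abs, star_star]
  have hcomm : S * (CFC.abs S + r • 1) = (T + r • 1) * S := by
    rw [mul_add, add_mul, mul_cfcAbs_eq, ← hT]; simp
  have h1 : S * Ring.inverse (CFC.abs S + r • 1) = Ring.inverse (T + r • 1) * S := by
    calc _ = Ring.inverse (T + r • 1) * ((T + r • 1) * S) * Ring.inverse (CFC.abs S + r • 1) := by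
          rw [← mul_assoc, Ring.inverse_mul_cancel _ hR.isUnit, one_mul]
      _ = _ := by
          rw [← hcomm, mul_assoc, mul_assoc, Ring.mul_inverse_cancel _ hQ.isUnit, mul_one]
  have hTnn : 0 ≤ T := CFC.abs_nonneg _
  have h2 : Ring.inverse (T + r • 1) * T = 1 - r • Ring.inverse (T + r • 1) := by
    have := Ring.inverse_mul_cancel _ hR.isUnit
    rwa [mul_add, mul_smul_comm, mul_one, ← eq_sub_iff_add_eq] at this
  have h3 : T * Ring.inverse (T + r • 1) = 1 - r • Ring.inverse (T + r • 1) := by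
    have := Ring.mul_inverse_cancel _ hR.isUnit
    rwa [add_mul, smul_mul_assoc, one_mul, ← eq_sub_iff_add_eq] at this
  rw [h1, mul_assoc, ← hTT, ← mul_assoc, h2, sub_mul, one_mul, sub_le_self_iff, smul_mul_assoc]
  refine smul_nonneg hr.le ?_
  exact (show Commute _ _ from h2.trans h3.symm).mul_nonneg (hR.ringInverse).nonneg hTnn

/-- With `Q = |S| + r` and `c = Q^{-1/2} S Q^{-1/2}`, the bound `S Q⁻¹ S⋆ ≤ |S⋆| ≤ |S| ≤ Q` gives
`c c⋆ ≤ Q^{-1/2} Q Q^{-1/2} = 1`. -/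
theorem IsSemiHyponormal.norm_rpow_mul_mul_rpow_le_one {S : A} (hS : IsSemiHyponormal S)
    {r : ℝ} (hr : 0 < r) :
    ‖(CFC.abs S + r • 1) ^ (-(1 / 2) : ℝ) * S * (CFC.abs S + r • 1) ^ (-(1 / 2) : ℝ)‖ ≤ 1 := by
  have hQ := isStrictlyPositive_cfcAbs_add S hr
  set Q := CFC.abs S + r • 1 with hQdef
  set b := Q ^ (-(1 / 2) : ℝ) with hb
  have hbs : IsSelfAdjoint b := CFC.rpow_nonneg.isSelfAdjoint
  have hbb : b * b = Ring.inverse Q := by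
    rw [hb, ← CFC.rpow_add hQ.isUnit, CFC.inverse_eq_rpow_neg_one hQ]
    norm_num
  have hbQ : b * Q * b = 1 := CFC.conjugate_rpow_neg_one_half Q hQ
  have h1 : S * Ring.inverse Q * star S ≤ Q :=
    (mul_inverse_cfcAbs_add_mul_star_le S hr).trans
      (hS.trans (le_add_of_nonneg_right (smul_nonneg hr.le zero_le_one)))
  have h2 : (b * S * b) * star (b * S * b) ≤ 1 := by
    calc _ = b * (S * Ring.inverse Q * star S) * b := by
          rw [← hbb, star_mul, star_mul, hbs.star_eq]; noncomm_ring
      _ ≤ b * Q * b := hbs.conjugate_le_conjugate h1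
      _ = 1 := hbQ
  have h3 := (CStarAlgebra.norm_le_one_iff_of_nonneg _ (mul_star_self_nonneg _)).mpr h2
  rw [CStarRing.norm_self_mul_star] at h3
  nlinarith [norm_nonneg (b * S * b)]

variable {H : Type*} [NormedAddCommGroup H] [InnerProductSpace ℂ H] [CompleteSpace H]

/-- With `Q = |S| + r` and `c = Q^{-1/2} S Q^{-1/2}` a contraction, the positive map
`X ↦ Φ (Q^{1/2} X Q^{1/2})` sends `1` to `Φ Q` and `c` to `Φ S`. -/
theorem IsSemiHyponormal.isPosBlock_map_add {S : A} (hS : IsSemiHyponormal S)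
    (Φ : A →ₚ[ℂ] (H →L[ℂ] H)) {r : ℝ} (hr : 0 < r) :
    IsPosBlock (Φ (CFC.abs S + r • 1)) (Φ (CFC.abs S + r • 1)) (Φ S) := by
  have hQ := isStrictlyPositive_cfcAbs_add S hr
  have hnorm := hS.norm_rpow_mul_mul_rpow_le_one hr
  set Q := CFC.abs S + r • 1 with hQdef
  set a := Q ^ (1 / 2 : ℝ) with ha
  set b := Q ^ (-(1 / 2) : ℝ) with hb
  have has : IsSelfAdjoint a := CFC.rpow_nonneg.isSelfAdjoint
  have haa : a * a = Q := by
    rw [ha, ← CFC.rpow_add hQ.isUnit]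
    norm_num
    exact CFC.rpow_one Q hQ.nonneg
  have hab : a * b = 1 := CFC.rpow_mul_rpow_neg _ hQ
  have hba : b * a = 1 := CFC.rpow_neg_mul_rpow _ hQ
  let Ψ : A →ₚ[ℂ] (H →L[ℂ] H) := PositiveLinearMap.mk₀
    (Φ.toLinearMap ∘ₗ LinearMap.mulLeftRight ℂ (a, a))
    (fun x hx => Φ.map_nonneg (has.conjugate_nonneg hx))
  have hΨ : ∀ x, Ψ x = Φ (a * x * a) := fun x => rfl
  have h := isPosBlock_map_of_norm_le_one Ψ hnorm
  have e : a * (b * S * b) * a = S := by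
    rw [mul_assoc, mul_assoc, hba, mul_one, ← mul_assoc, hab, one_mul]
  rwa [hΨ, hΨ, mul_one, haa, e] at h

/-- For semi-hyponormal `S` the block `[[|S|, S⋆], [S, |S|]]` is positive, and every positive map
preserves its positivity. -/
theorem IsSemiHyponormal.isPosBlock_map {S : A} (hS : IsSemiHyponormal S)
    (Φ : A →ₚ[ℂ] (H →L[ℂ] H)) : IsPosBlock (Φ (CFC.abs S)) (Φ (CFC.abs S)) (Φ S) := by
  have hlim : Tendsto (fun r : ℝ => Φ (CFC.abs S + r • 1)) (𝓝[>] 0) (𝓝 (Φ (CFC.abs S))) := by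
    have h1 : Tendsto (fun r : ℝ => CFC.abs S + r • (1 : A)) (𝓝 0)
        (𝓝 (CFC.abs S + (0 : ℝ) • (1 : A))) :=
      (continuous_const.add (continuous_id.smul continuous_const)).tendsto 0
    rw [zero_smul, add_zero] at h1
    exact ((map_continuous Φ).tendsto _).comp (h1.mono_left nhdsWithin_le_nhds)
  exact IsPosBlock.of_tendsto hlim hlim tendsto_const_nhds
    (eventually_nhdsWithin_of_forall fun r hr => hS.isPosBlock_map_add Φ hr)

end SemiHyponormal

/-! ### The inequality for sums of semi-hyponormal elements -/

theorem theorem2p6 {A : Type*} [CStarAlgebra A] [PartialOrder A] [StarOrderedRing A]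
    {H : Type*} [NormedAddCommGroup H] [InnerProductSpace ℂ H] [CompleteSpace H]
    (Φ : A →ₚ[ℂ] (H →L[ℂ] H)) {m : ℕ} (S : Fin m → A) (hS : ∀ k, IsSemiHyponormal (S k)) :
    ∃ V : H →L[ℂ] H, IsPartialIsometry V ∧
      ∃ G : H →L[ℂ] H,
        IsGeomMean (Φ (∑ k, CFC.abs (S k))) (V * Φ (∑ k, CFC.abs (S k)) * star V) G ∧
          CFC.abs (Φ (∑ k, S k)) ≤ G := by
  have hsum : IsPosBlock (Φ (∑ k, CFC.abs (S k))) (Φ (∑ k, CFC.abs (S k))) (Φ (∑ k, S k)) := by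
    simp only [map_sum]
    exact IsPosBlock.sum _ fun k _ => (hS k).isPosBlock_map Φ
  have hpos : 0 ≤ Φ (∑ k, CFC.abs (S k)) :=
    Φ.map_nonneg (Finset.sum_nonneg fun k _ => CFC.abs_nonneg (S k))
  obtain ⟨V, hV, hVT⟩ := exists_isPartialIsometry_mul_eq_cfcAbs (Φ (∑ k, S k))
  refine ⟨V, hV, ?_⟩
  -- Conjugation by `diag(1, V⋆)` replaces the corner by `V Φ(∑ S_k) = |Φ(∑ S_k)|`.
  have h := hsum.conj 1 (star V)
  rw [star_star, star_one, one_mul, mul_one, mul_one, hVT] at h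
  exact h.exists_isGeomMean_ge hpos (star_right_conjugate_nonneg hpos V) (CFC.abs_nonneg _)
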